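/- Conventions. For $\pi\in S_n$, written $\pi=\pi(1)\pi(2)\cdots\pi(n)$, let $E(\pi)=\{(i,j): i<j,\ \pi^{-1}(i)>\pi^{-1}(j)\}$ be its inversion set, $G(\pi)$ the graph on $\{1,\dots,n\}$ in which $i<j$ are adjacent iff $(i,j)\in E(\pi)$, $D(\pi)$ the digraph on $\{1,\dots,n\}$ with arc set $E(\pi)$, and $\pi^c=\pi(n)\cdots\pi(2)\pi(1)$. A geometric graph is a simple graph with a straight-line drawing in the plane in which no three vertices are collinear and no three edges cross at one point; a geo-isomorphism is a bijection of the vertices that preserves adjacency, non-adjacency, and the crossing and non-crossing of pairs of edges. The geometric graph $\overline K_{2,n}(\pi)$ is obtained as follows: from two points $a,b$ draw $n$ rays each, on the same side of the line $ab$, so that each ray from $a$ meets each ray from $b$; in order of increasing angle with the segment $ab$, label the rays from $b$ by $1,\dots,n$ and those from $a$ by $\pi(1),\dots,\pi(n)$; vertex $i$ is the intersection of the two rays labelled $i$ (the rays being chosen in general position), and every $i$ is joined to $a$ and to $b$. Permutations $\sigma,\pi\in S_n$ are geo-equivalent if $\overline K_{2,n}(\sigma)$ and $\overline K_{2,n}(\pi)$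 are geo-isomorphic, and $[\pi]$ is the geo-equivalence class of $\pi$. A module of a graph $G=(V,E)$ is a non-empty set $M\subseteq V$ such that each vertex outside $M$ is adjacent to all vertices of $M$ or to none; $V$ and the singletons are the trivial modules. A transitive orientation of $G$ directs each edge of $G$ in exactly one way so that the resulting set of arcs is a transitive relation. A geo-equivalence class $C$ is represented by an orientation $F$ of $G$ if the digraph $(V,F)$ is isomorphic to $D(\sigma)$ for some $\sigma\in C$. Statement. Let $\pi\in S_n$ be such that $G=G(\pi)$ has only trivial modules. Then, as a set, $$[\pi]=\bigl\{\pi,\ \pi^{-1},\ ((\pi^c)^{-1})^c,\ (((\pi^c)^{-1})^c)^{-1}\bigr\},$$ and the multiset on the right has four, two or one distinct elements. Moreover, $[\pi]$ is represented by a transitive orientation of $G$, and it is the only geo-equivalence class of $S_n$ that is represented by a transitive orientation of $G$. Each of the values four, two and one occurs for some $\pi\in S_n$ with $n\ge 4$ such that $G(\pi)$ has only trivial modules. -/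

import Mathlib

/-! ## Geometric graphs -/

/-- A geometric graph: a simple graph with a straight-line drawing in the plane, the vertices being
in general position (no three vertices collinear) and no three edges crossing at a single point.
The edge `uv` is drawn as the segment from `pos u` to `pos v`. -/
structure GeometricGraph (V : Type*) where
  graph : SimpleGraph V
  pos : V → ℝ × ℝ
  pos_injective : Function.Injective pos
  not_collinear : ∀ u v w : V, u ≠ v → u ≠ w → v ≠ w →
    ¬ Collinear ℝ {pos u, pos v, pos w}
  not_concurrent : ∀ u₁ v₁ u₂ v₂ u₃ v₃ : V,
    graph.Adj u₁ v₁ → graph.Adj u₂ v₂ → graph.Adj u₃ v₃ →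
    s(u₁, v₁) ≠ s(u₂, v₂) → s(u₁, v₁) ≠ s(u₃, v₃) → s(u₂, v₂) ≠ s(u₃, v₃) →
    ¬ ∃ p, p ∈ openSegment ℝ (pos u₁) (pos v₁) ∧ p ∈ openSegment ℝ (pos u₂) (pos v₂) ∧
      p ∈ openSegment ℝ (pos u₃) (pos v₃)

/-- `xy` crosses `uv`: these are two distinct edges, and they have a common interior point. -/
def GeometricGraph.Crosses {V : Type*} (G : GeometricGraph V) (x y u v : V) : Prop :=
  G.graph.Adj x y ∧ G.graph.Adj u v ∧ s(x, y) ≠ s(u, v) ∧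
    (openSegment ℝ (G.pos x) (G.pos y) ∩ openSegment ℝ (G.pos u) (G.pos v)).Nonempty

/-- A geo-isomorphism: a bijection of the vertices that preserves adjacency, non-adjacency,
crossings and non-crossings. -/
structure GeoIso {V W : Type*} (G : GeometricGraph V) (H : GeometricGraph W) where
  toEquiv : V ≃ W
  adj_iff : ∀ u v, G.graph.Adj u v ↔ H.graph.Adj (toEquiv u) (toEquiv v)
  crosses_iff : ∀ x y u v, G.Crosses x y u v ↔
    H.Crosses (toEquiv x) (toEquiv y) (toEquiv u) (toEquiv v)

/-! ## The realization of `K_{2,n}` given by a permutation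

The vertices of `K_{2,n}` are `a = Sum.inl 0`, `b = Sum.inl 1` and `Sum.inr i` for `i : Fin n`;
here `Fin n` plays the part of `{1, …, n}`. -/

/-- Slope of the `k`-th ray of the template from `a = (0, 0)`: the ray
`{(x, slopeA n k * x) | 0 ≤ x}`. -/
noncomputable def slopeA (n : ℕ) (k : Fin n) : ℝ := ((n : ℝ) + 1) ^ (k : ℕ)

/-- Slope of the `k`-th ray of the template from `b = (1, 0)`: the ray
`{(x, slopeB n k * (1 - x)) | x ≤ 1}`. -/
noncomputable def slopeB (n : ℕ) (k : Fin n) : ℝ := ((n : ℝ) - (k : ℕ))⁻¹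

theorem slopeA_pos (n : ℕ) (k : Fin n) : 0 < slopeA n k := by
  unfold slopeA; positivity

theorem slopeB_pos (n : ℕ) (k : Fin n) : 0 < slopeB n k := by
  have : ((k : ℕ) : ℝ) < n := by exact_mod_cast k.2
  unfold slopeB
  exact inv_pos.2 (by linarith)

/-- The rays from `a` are listed by increasing angle with `ab`. -/
theorem slopeA_strictMono (n : ℕ) : StrictMono (slopeA n) := by
  intro k l hkl
  have hn : 0 < n := lt_of_le_of_lt (Nat.zero_le _) k.2
  have h1 : (1 : ℝ) < (n : ℝ) + 1 := by
    have : (0 : ℝ) < n := by exact_mod_cast hn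
    linarith
  exact pow_lt_pow_right₀ h1 hkl

/-- The rays from `b` are listed by increasing angle with `ba`. -/
theorem slopeB_strictMono (n : ℕ) : StrictMono (slopeB n) := by
  intro k l hkl
  have h1 : ((l : ℕ) : ℝ) < n := by exact_mod_cast l.2
  have h2 : ((k : ℕ) : ℝ) < (l : ℕ) := by exact_mod_cast hkl
  unfold slopeB
  exact inv_strictAnti₀ (by linarith) (by linarith)

/-- The rays from `b` are labelled `1, …, n` and those from `a` are labelled `π(1), …, π(n)`;
the vertex `i` is the intersection of the two rays labelled `i`. -/
noncomputable def vertexPoint {n : ℕ} (π : Equiv.Perm (Fin n)) (i : Fin n) : ℝ × ℝ :=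
  (slopeB n i / (slopeA n (π⁻¹ i) + slopeB n i),
    slopeA n (π⁻¹ i) * slopeB n i / (slopeA n (π⁻¹ i) + slopeB n i))

theorem vertexPoint_rayA {n : ℕ} (π : Equiv.Perm (Fin n)) (i : Fin n) :
    (vertexPoint π i).2 = slopeA n (π⁻¹ i) * (vertexPoint π i).1 := by
  simp only [vertexPoint]; ring

theorem vertexPoint_rayB {n : ℕ} (π : Equiv.Perm (Fin n)) (i : Fin n) :
    (vertexPoint π i).2 = slopeB n i * (1 - (vertexPoint π i).1) := by
  have := slopeA_pos n (π⁻¹ i)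
  have := slopeB_pos n i
  simp only [vertexPoint]; field_simp; ring

theorem vertexPoint_fst_pos {n : ℕ} (π : Equiv.Perm (Fin n)) (i : Fin n) :
    0 < (vertexPoint π i).1 := by
  have := slopeA_pos n (π⁻¹ i)
  have := slopeB_pos n i
  simp only [vertexPoint]; positivity

theorem vertexPoint_snd_pos {n : ℕ} (π : Equiv.Perm (Fin n)) (i : Fin n) :
    0 < (vertexPoint π i).2 := by
  have := slopeA_pos n (π⁻¹ i)
  have := slopeB_pos n i
  simp only [vertexPoint]; positivity

theorem vertexPoint_fst_lt_one {n : ℕ} (π : Equiv.Perm (Fin n)) (i : Fin n) :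
    (vertexPoint π i).1 < 1 := by
  have h1 := vertexPoint_snd_pos π i
  rw [vertexPoint_rayB] at h1
  have := (mul_pos_iff_of_pos_left (slopeB_pos n i)).1 h1
  linarith

/-- Position of the vertices: `a = (0, 0)`, `b = (1, 0)`, and `i` as above. -/
noncomputable def realizationPos {n : ℕ} (π : Equiv.Perm (Fin n)) : Fin 2 ⊕ Fin n → ℝ × ℝ :=
  Sum.elim ![(0, 0), (1, 0)] (vertexPoint π)

/-! ### The realization is in general position -/

/-- Twice the signed area of the triangle `pqr`. -/
def crossDet (p q r : ℝ × ℝ) : ℝ :=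
  (q.1 - p.1) * (r.2 - p.2) - (r.1 - p.1) * (q.2 - p.2)

theorem crossDet_eq_zero_of_collinear {p q r : ℝ × ℝ} (h : Collinear ℝ {p, q, r}) :
    crossDet p q r = 0 := by
  rw [collinear_iff_of_mem (p₀ := p) (by simp)] at h
  obtain ⟨v, hv⟩ := h
  obtain ⟨x, hx⟩ := hv q (by simp)
  obtain ⟨y, hy⟩ := hv r (by simp)
  simp only [crossDet, hx, hy, vadd_eq_add, Prod.fst_add, Prod.snd_add, Prod.smul_fst,
    Prod.smul_snd, smul_eq_mul]
  ring

theorem vertexPoint_eq {n : ℕ} (π : Equiv.Perm (Fin n)) (i : Fin n) :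
    vertexPoint π i =
      ((slopeA n (π⁻¹ i))⁻¹ / ((slopeA n (π⁻¹ i))⁻¹ + (slopeB n i)⁻¹),
        1 / ((slopeA n (π⁻¹ i))⁻¹ + (slopeB n i)⁻¹)) := by
  have := slopeA_pos n (π⁻¹ i)
  have := slopeB_pos n i
  simp only [vertexPoint, Prod.mk.injEq]
  constructor <;> field_simp <;> ring

theorem slope_det_ne_zero_of_lt (n : ℕ) (p q r i j k : Fin n) (hpq : p < q) (hqr : q < r)
    (hjk : j ≠ k) :
    ((slopeA n p)⁻¹ - (slopeA n q)⁻¹) * ((slopeB n j)⁻¹ - (slopeB n k)⁻¹)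
      - ((slopeA n q)⁻¹ - (slopeA n r)⁻¹) * ((slopeB n i)⁻¹ - (slopeB n j)⁻¹) ≠ 0 := by
  intro h
  have hA : ((n : ℝ) + 1) * (slopeA n q)⁻¹ ≤ (slopeA n p)⁻¹ := by
    have hn : (1 : ℝ) ≤ (n : ℝ) + 1 := by linarith [(Nat.cast_nonneg n : (0 : ℝ) ≤ n)]
    have h1 : slopeA n p * ((n : ℝ) + 1) ≤ slopeA n q := by
      unfold slopeA
      rw [← pow_succ]
      exact pow_le_pow_right₀ hn hpq
    have hp := slopeA_pos n p
    have hq := slopeA_pos n q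
    rw [← div_eq_mul_inv, ← one_div, div_le_div_iff₀ hq hp]
    linarith
  have hq := inv_pos.2 (slopeA_pos n q)
  have hr := inv_pos.2 (slopeA_pos n r)
  have hqr' : (slopeA n r)⁻¹ < (slopeA n q)⁻¹ :=
    inv_strictAnti₀ (slopeA_pos n q) (slopeA_strictMono n hqr)
  simp only [slopeB, inv_inv] at h
  have hi : ((i : ℕ) : ℝ) < n := by exact_mod_cast i.2
  have hj : ((j : ℕ) : ℝ) < n := by exact_mod_cast j.2
  have hi0 : (0 : ℝ) ≤ (i : ℕ) := Nat.cast_nonneg _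
  have hj0 : (0 : ℝ) ≤ (j : ℕ) := Nat.cast_nonneg _
  have habs : |((k : ℕ) : ℝ) - (j : ℕ)| ≥ 1 := by
    have : ((k : ℕ) : ℤ) - (j : ℕ) ≠ 0 := by
      have := Fin.val_ne_of_ne hjk
      omega
    exact_mod_cast Int.one_le_abs this
  have habs' : |((j : ℕ) : ℝ) - (i : ℕ)| < n := by
    rw [abs_lt]; constructor <;> linarith
  have h' : ((slopeA n p)⁻¹ - (slopeA n q)⁻¹) * |((k : ℕ) : ℝ) - (j : ℕ)|
      = ((slopeA n q)⁻¹ - (slopeA n r)⁻¹) * |((j : ℕ) : ℝ) - (i : ℕ)| := by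
    have hn : (0 : ℝ) ≤ n := Nat.cast_nonneg n
    have h1 : (0 : ℝ) ≤ (slopeA n p)⁻¹ - (slopeA n q)⁻¹ := by nlinarith
    have h2 : (0 : ℝ) ≤ (slopeA n q)⁻¹ - (slopeA n r)⁻¹ := by linarith
    rw [← abs_of_nonneg h1, ← abs_of_nonneg h2, ← abs_mul, ← abs_mul]
    congr 1
    linarith
  have h0 := abs_nonneg (((j : ℕ) : ℝ) - (i : ℕ))
  have e1 : (n : ℝ) * (slopeA n q)⁻¹
      ≤ ((slopeA n p)⁻¹ - (slopeA n q)⁻¹) * |((k : ℕ) : ℝ) - (j : ℕ)| := by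
    have : (0 : ℝ) ≤ n := Nat.cast_nonneg n
    have h1 : (n : ℝ) * (slopeA n q)⁻¹ ≤ (slopeA n p)⁻¹ - (slopeA n q)⁻¹ := by linarith
    have h2 : (0 : ℝ) ≤ (n : ℝ) * (slopeA n q)⁻¹ := by positivity
    nlinarith
  have e2 : ((slopeA n q)⁻¹ - (slopeA n r)⁻¹) * |((j : ℕ) : ℝ) - (i : ℕ)|
      < (slopeA n q)⁻¹ * n := by
    calc _ ≤ (slopeA n q)⁻¹ * |((j : ℕ) : ℝ) - (i : ℕ)| := by
          apply mul_le_mul_of_nonneg_right _ h0; linarith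
      _ < _ := mul_lt_mul_of_pos_left habs' hq
  linarith

theorem crossDet_vertexPoint_ne_zero {n : ℕ} (π : Equiv.Perm (Fin n)) {i j k : Fin n}
    (hij : i ≠ j) (hik : i ≠ k) (hjk : j ≠ k) :
    crossDet (vertexPoint π i) (vertexPoint π j) (vertexPoint π k) ≠ 0 := by
  intro h
  have hpq : π⁻¹ i ≠ π⁻¹ j := fun e => hij (π⁻¹.injective e)
  have hpr : π⁻¹ i ≠ π⁻¹ k := fun e => hik (π⁻¹.injective e)
  have hqr : π⁻¹ j ≠ π⁻¹ k := fun e => hjk (π⁻¹.injective e)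
  have key : ∀ U₁ V₁ U₂ V₂ U₃ V₃ : ℝ, 0 < U₁ → 0 < V₁ → 0 < U₂ → 0 < V₂ → 0 < U₃ → 0 < V₃ →
      crossDet (U₁ / (U₁ + V₁), 1 / (U₁ + V₁)) (U₂ / (U₂ + V₂), 1 / (U₂ + V₂))
        (U₃ / (U₃ + V₃), 1 / (U₃ + V₃)) = 0 →
      (U₁ - U₂) * (V₂ - V₃) - (U₂ - U₃) * (V₁ - V₂) = 0 := by
    intro U₁ V₁ U₂ V₂ U₃ V₃ h1 h2 h3 h4 h5 h6 h
    have e1 : (0 : ℝ) < U₁ + V₁ := by positivity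
    have e2 : (0 : ℝ) < U₂ + V₂ := by positivity
    have e3 : (0 : ℝ) < U₃ + V₃ := by positivity
    have : crossDet (U₁ / (U₁ + V₁), 1 / (U₁ + V₁)) (U₂ / (U₂ + V₂), 1 / (U₂ + V₂))
        (U₃ / (U₃ + V₃), 1 / (U₃ + V₃)) =
        -((U₁ - U₂) * (V₂ - V₃) - (U₂ - U₃) * (V₁ - V₂)) /
          ((U₁ + V₁) * (U₂ + V₂) * (U₃ + V₃)) := by
      simp only [crossDet]
      field_simp
      ring
    rw [this, div_eq_zero_iff] at h
    rcases h with h | h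
    · linarith
    · exact absurd h (by positivity)
  simp only [vertexPoint_eq] at h
  have h := key _ _ _ _ _ _ (inv_pos.2 (slopeA_pos n _)) (inv_pos.2 (slopeB_pos n _))
    (inv_pos.2 (slopeA_pos n _)) (inv_pos.2 (slopeB_pos n _))
    (inv_pos.2 (slopeA_pos n _)) (inv_pos.2 (slopeB_pos n _)) h
  rcases lt_or_gt_of_ne hpq with a | a <;> rcases lt_or_gt_of_ne hpr with b | b <;>
    rcases lt_or_gt_of_ne hqr with c | c
  · exact slope_det_ne_zero_of_lt n _ _ _ i j k a c hjk (by linarith)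
  · exact slope_det_ne_zero_of_lt n _ _ _ i k j b c hjk.symm (by linarith)
  · exact absurd (a.trans c) (not_lt_of_gt b)
  · exact slope_det_ne_zero_of_lt n _ _ _ k i j b a hij (by linarith)
  · exact slope_det_ne_zero_of_lt n _ _ _ j i k a b hik (by linarith)
  · exact absurd (c.trans a) (not_lt_of_gt b)
  · exact slope_det_ne_zero_of_lt n _ _ _ j k i c b hik.symm (by linarith)
  · exact slope_det_ne_zero_of_lt n _ _ _ k j i c a hij.symm (by linarith)

theorem crossDet_swap_left (p q r : ℝ × ℝ) : crossDet q p r = -crossDet p q r := by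
  simp only [crossDet]; ring

theorem crossDet_swap_right (p q r : ℝ × ℝ) : crossDet p r q = -crossDet p q r := by
  simp only [crossDet]; ring

theorem crossDet_one_two_ne_zero {n : ℕ} (π : Equiv.Perm (Fin n)) {i j : Fin n} (hij : i ≠ j)
    (c : Fin 2) :
    crossDet (realizationPos π (.inl c)) (vertexPoint π i) (vertexPoint π j) ≠ 0 := by
  have xi := vertexPoint_fst_pos π i
  have xj := vertexPoint_fst_pos π j
  have zi := vertexPoint_fst_lt_one π i
  have zj := vertexPoint_fst_lt_one π j
  intro h
  fin_cases c
  · simp only [crossDet, realizationPos, Sum.elim_inl, Fin.zero_eta, Matrix.cons_val_zero,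
      sub_zero, vertexPoint_rayA] at h
    have h1 : ((vertexPoint π i).1 * (vertexPoint π j).1) *
      (slopeA n (π⁻¹ j) - slopeA n (π⁻¹ i)) = 0 := by linarith
    rcases mul_eq_zero.1 h1 with h1 | h1
    · exact absurd h1 (by positivity)
    · exact hij (π⁻¹.injective ((slopeA_strictMono n).injective (by linarith)))
  · simp only [crossDet, realizationPos, Sum.elim_inl, Fin.mk_one, Matrix.cons_val_one,
      Matrix.cons_val_fin_one, sub_zero, vertexPoint_rayB] at h
    have h1 : ((1 - (vertexPoint π i).1) * (1 - (vertexPoint π j).1)) *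
      (slopeB n i - slopeB n j) = 0 := by linarith
    rcases mul_eq_zero.1 h1 with h1 | h1
    · have : 0 < 1 - (vertexPoint π i).1 := by linarith
      have : 0 < 1 - (vertexPoint π j).1 := by linarith
      exact absurd h1 (by positivity)
    · exact hij ((slopeB_strictMono n).injective (by linarith))

theorem crossDet_two_one_ne_zero {n : ℕ} (π : Equiv.Perm (Fin n)) (i : Fin n) {c d : Fin 2}
    (hcd : c ≠ d) :
    crossDet (realizationPos π (.inl c)) (realizationPos π (.inl d)) (vertexPoint π i) ≠ 0 := by
  have yi := vertexPoint_snd_pos π i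
  intro h
  fin_cases c <;> fin_cases d <;>
    simp [crossDet, realizationPos] at h hcd <;> linarith

theorem crossDet_realizationPos_ne_zero {n : ℕ} (π : Equiv.Perm (Fin n)) (u v w : Fin 2 ⊕ Fin n)
    (huv : u ≠ v) (huw : u ≠ w) (hvw : v ≠ w) :
    crossDet (realizationPos π u) (realizationPos π v) (realizationPos π w) ≠ 0 := by
  rcases u with c | i <;> rcases v with d | j <;> rcases w with e | k <;>
    simp only [ne_eq, Sum.inl.injEq, Sum.inr.injEq] at huv huw hvw
  · omega
  · exact crossDet_two_one_ne_zero π k huv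
  · rw [crossDet_swap_right, neg_ne_zero]
    exact crossDet_two_one_ne_zero π j huw
  · exact crossDet_one_two_ne_zero π hvw c
  · rw [crossDet_swap_left, crossDet_swap_right, neg_neg]
    exact crossDet_two_one_ne_zero π i hvw
  · rw [crossDet_swap_left, neg_ne_zero]
    exact crossDet_one_two_ne_zero π huw d
  · rw [crossDet_swap_right, crossDet_swap_left, neg_neg]
    exact crossDet_one_two_ne_zero π huv e
  · exact crossDet_vertexPoint_ne_zero π huv huw hvw

theorem realizationPos_injective {n : ℕ} (π : Equiv.Perm (Fin n)) :
    Function.Injective (realizationPos π) := by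
  intro u v h
  by_contra huv
  by_cases hw : ∃ w, u ≠ w ∧ v ≠ w
  · obtain ⟨w, h1, h2⟩ := hw
    apply crossDet_realizationPos_ne_zero π u v w huv h1 h2
    rw [h]
    simp [crossDet]
  · push Not at hw
    rcases u with c | i <;> rcases v with d | j
    · have hcd : c ≠ d := fun e => huv (by rw [e])
      fin_cases c <;> fin_cases d <;> simp [realizationPos] at h hcd
    · have h1 := hw (.inl (c + 1)) (by fin_cases c <;> simp)
      simp at h1
    · have h1 := hw (.inl (d + 1)) (by simp)
      have h2 : d ≠ d + 1 := by fin_cases d <;> simp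
      simp only [Sum.inl.injEq] at h1
      exact h2 h1
    · have h1 := hw (.inl 0) (by simp)
      simp at h1

/-- Distinct edges with a common end have no common interior point. -/
theorem not_openSegment_realizationPos {n : ℕ} (π : Equiv.Perm (Fin n)) (c : Fin 2) (i j : Fin n)
    (hij : i ≠ j) (p : ℝ × ℝ)
    (h1 : p ∈ openSegment ℝ (realizationPos π (.inl c)) (realizationPos π (.inr i)))
    (h2 : p ∈ openSegment ℝ (realizationPos π (.inl c)) (realizationPos π (.inr j))) : False := by
  obtain ⟨x, y, hx, hy, hxy, rfl⟩ := h1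
  obtain ⟨z, w, hz, hw, hzw, h⟩ := h2
  apply crossDet_realizationPos_ne_zero π (.inl c) (.inr i) (.inr j) (by simp) (by simp)
    (by simpa using hij)
  generalize realizationPos π (.inl c) = a at *
  generalize realizationPos π (.inr i) = q at *
  generalize realizationPos π (.inr j) = r at *
  have e1 := congrArg Prod.fst h
  have e2 := congrArg Prod.snd h
  simp only [Prod.fst_add, Prod.snd_add, Prod.smul_fst, Prod.smul_snd, smul_eq_mul] at e1 e2
  have hx' : x = 1 - y := by linarith
  have hz' : z = 1 - w := by linarith
  subst hx' hz'
  have f1 : w * (r.1 - a.1) = y * (q.1 - a.1) := by linarith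
  have f2 : w * (r.2 - a.2) = y * (q.2 - a.2) := by linarith
  have : w * crossDet a q r = 0 := by
    simp only [crossDet]
    linear_combination (q.1 - a.1) * f2 - (q.2 - a.2) * f1
  exact (mul_eq_zero.1 this).resolve_left hw.ne'

/-- Every edge of `K_{2,n}` joins `a` or `b` to some `i`. -/
theorem completeBipartite_edge_cases {n : ℕ} (π : Equiv.Perm (Fin n)) (u v : Fin 2 ⊕ Fin n)
    (h : (completeBipartiteGraph (Fin 2) (Fin n)).Adj u v) :
    ∃ c i, s(u, v) = s(.inl c, .inr i) ∧
      openSegment ℝ (realizationPos π u) (realizationPos π v) =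
        openSegment ℝ (realizationPos π (.inl c)) (realizationPos π (.inr i)) := by
  rcases u with c | i <;> rcases v with d | j
  · simp at h
  · exact ⟨c, j, rfl, rfl⟩
  · exact ⟨d, i, Sym2.eq_swap, openSegment_symm _ _ _⟩
  · simp at h

/-- The geometric realization of `K_{2,n}` that corresponds to the permutation `π`. -/
noncomputable def permRealization {n : ℕ} (π : Equiv.Perm (Fin n)) :
    GeometricGraph (Fin 2 ⊕ Fin n) where
  graph := completeBipartiteGraph (Fin 2) (Fin n)
  pos := realizationPos π
  pos_injective := realizationPos_injective π
  not_collinear u v w huv huw hvw h :=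
    crossDet_realizationPos_ne_zero π u v w huv huw hvw (crossDet_eq_zero_of_collinear h)
  not_concurrent u₁ v₁ u₂ v₂ u₃ v₃ a₁ a₂ a₃ h₁₂ h₁₃ h₂₃ := by
    rintro ⟨p, p₁, p₂, p₃⟩
    obtain ⟨c₁, i₁, e₁, s₁⟩ := completeBipartite_edge_cases π u₁ v₁ a₁
    obtain ⟨c₂, i₂, e₂, s₂⟩ := completeBipartite_edge_cases π u₂ v₂ a₂
    obtain ⟨c₃, i₃, e₃, s₃⟩ := completeBipartite_edge_cases π u₃ v₃ a₃
    rw [s₁] at p₁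
    rw [s₂] at p₂
    rw [s₃] at p₃
    rw [e₁, e₂] at h₁₂
    rw [e₁, e₃] at h₁₃
    rw [e₂, e₃] at h₂₃
    have hc : c₁ = c₂ ∨ c₁ = c₃ ∨ c₂ = c₃ := by omega
    rcases hc with rfl | rfl | rfl
    · exact not_openSegment_realizationPos π c₁ i₁ i₂ (fun e => h₁₂ (by rw [e])) p p₁ p₂
    · exact not_openSegment_realizationPos π c₁ i₁ i₃ (fun e => h₁₃ (by rw [e])) p p₁ p₃
    · exact not_openSegment_realizationPos π c₂ i₂ i₃ (fun e => h₂₃ (by rw [e])) p p₂ p₃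

/-! ## Geo-equivalence of permutations -/

/-- Two permutations are geo-equivalent if their realizations of `K_{2,n}` are geo-isomorphic. -/
def GeoEquiv {n : ℕ} (σ π : Equiv.Perm (Fin n)) : Prop :=
  Nonempty (GeoIso (permRealization σ) (permRealization π))

/-- Geo-equivalence as an equivalence relation on the symmetric group. -/
def geoSetoid (n : ℕ) : Setoid (Equiv.Perm (Fin n)) where
  r := GeoEquiv
  iseqv :=
    { refl := fun _ => ⟨⟨Equiv.refl _, fun _ _ => Iff.rfl, fun _ _ _ _ => Iff.rfl⟩⟩
      symm := fun ⟨f⟩ => ⟨⟨f.toEquiv.symm, fun u v => by simp [f.adj_iff],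
        fun x y u v => by simp [f.crosses_iff]⟩⟩
      trans := fun ⟨f⟩ ⟨g⟩ => ⟨⟨f.toEquiv.trans g.toEquiv,
        fun u v => (f.adj_iff u v).trans (g.adj_iff _ _),
        fun x y u v => (f.crosses_iff x y u v).trans (g.crosses_iff _ _ _ _)⟩⟩ }

/-- The geo-equivalence class `[π]`. -/
def geoClass {n : ℕ} (π : Equiv.Perm (Fin n)) : Set (Equiv.Perm (Fin n)) :=
  {σ | GeoEquiv σ π}

/-! ## Permutation graphs and permutation digraphs -/

/-- The inversion set `E(π)`: pairs `i < j` with `π⁻¹(i) > π⁻¹(j)`. -/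
def inversionSet {n : ℕ} (π : Equiv.Perm (Fin n)) : Set (Fin n × Fin n) :=
  {p | p.1 < p.2 ∧ π⁻¹ p.2 < π⁻¹ p.1}

/-- The permutation graph `G(π)`. -/
def permGraph {n : ℕ} (π : Equiv.Perm (Fin n)) : SimpleGraph (Fin n) where
  Adj i j := (i, j) ∈ inversionSet π ∨ (j, i) ∈ inversionSet π
  symm := ⟨fun _ _ h => h.symm⟩
  loopless := ⟨fun _ h => h.elim (fun h => lt_irrefl _ h.1) (fun h => lt_irrefl _ h.1)⟩

/-- The permutation digraph `D(π)`. -/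
def permDigraph {n : ℕ} (π : Equiv.Perm (Fin n)) : Digraph (Fin n) where
  Adj i j := (i, j) ∈ inversionSet π

/-- The digraph `D` represents `π`: it is isomorphic to `D(π)`. -/
def Represents {V : Type*} {n : ℕ} (D : Digraph V) (π : Equiv.Perm (Fin n)) : Prop :=
  Nonempty (D.Adj ≃r (permDigraph π).Adj)

/-- `D` is a transitive orientation of `G`: each edge of `G` gets exactly one of its two
directions, there are no other arcs, and the arcs form a transitive relation. -/
structure IsTransitiveOrientation {V : Type*} (G : SimpleGraph V) (D : Digraph V) : Prop where
  adj_iff : ∀ u v, G.Adj u v ↔ D.Adj u v ∨ D.Adj v u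
  asymm : ∀ u v, D.Adj u v → ¬ D.Adj v u
  trans : ∀ u v w, D.Adj u v → D.Adj v w → D.Adj u w

/-- A module of `G`: each vertex outside `M` is adjacent to all of `M` or to no vertex of `M`. -/
def IsGraphModule {V : Type*} (G : SimpleGraph V) (M : Set V) : Prop :=
  ∀ v, v ∉ M → (∀ u ∈ M, G.Adj u v) ∨ (∀ u ∈ M, ¬ G.Adj u v)

/-- The only (nonempty) modules of `G` are the trivial ones: the whole vertex set and the
singletons. -/
def HasOnlyTrivialModules {V : Type*} (G : SimpleGraph V) : Prop :=
  ∀ M : Set V, M.Nonempty → IsGraphModule G M → M = Set.univ ∨ ∃ v, M = {v}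

/-! ## The four permutations -/

/-- The reverse `π^c = π(n) π(n-1) ⋯ π(1)` of `π`. -/
def permRev {n : ℕ} (π : Equiv.Perm (Fin n)) : Equiv.Perm (Fin n) :=
  π * Fin.revPerm

/-- The multiset `{π, π⁻¹, ((π^c)⁻¹)^c, (((π^c)⁻¹)^c)⁻¹}`. -/
def fourPerms {n : ℕ} (π : Equiv.Perm (Fin n)) : Multiset (Equiv.Perm (Fin n)) :=
  {π, π⁻¹, permRev (permRev π)⁻¹, (permRev (permRev π)⁻¹)⁻¹}

/-! The edge from `a` to `i` crosses the edge from `b` to `j` exactly when `(j, i)` is an inversion.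
Apart from the small case of the 4-cycle, a geo-isomorphism fixes or exchanges `a` and `b`. Hence
geo-equivalence means that the digraphs of inversions are isomorphic (`a`, `b` fixed) or
anti-isomorphic (`a`, `b` exchanged).

A permutation is a pair of linear orders, by label and by position. The label order is the union of
non-inversions and inversions, the position order that of non-inversions and reversed inversions.
Inversions transitively orient `G`, non-inversions its complement, and both graphs have only trivial
modules. By Gallai's forcing argument (`IsTransitiveOrientation.eq_or_reverse`) each orientation is
unique up to reversal. Once the inversion digraph is fixed up to isomorphism, only the choice
between the non-inversions and their reverse remains, so two permutations have that digraph
(`InversionIso.eq_or_eq`). Anti-isomorphism adds their inverses. The four permutations form an orbit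
of two commuting involutions, which gives the possible sizes. -/

/-! ## Uniqueness of transitive orientations -/

/-- The elementary forcing relation on ordered edges: an edge forces its reverse, and it forces each
edge with the same first vertex whose second vertex is not adjacent to its own. -/
def EdgeForces {V : Type*} (G : SimpleGraph V) (e f : V × V) : Prop :=
  G.Adj e.1 e.2 ∧ G.Adj f.1 f.2 ∧ ((f.1 = e.2 ∧ f.2 = e.1) ∨ (f.1 = e.1 ∧ ¬ G.Adj e.2 f.2))

/-- Two ordered edges are in the same forcing class. -/
def SameForcingClass {V : Type*} (G : SimpleGraph V) : V × V → V × V → Prop :=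
  Relation.ReflTransGen (EdgeForces G)

section Forcing

variable {V : Type*} {G : SimpleGraph V}

theorem EdgeForces.symm {e f : V × V} (h : EdgeForces G e f) : EdgeForces G f e := by
  obtain ⟨h1, h2, ⟨h3, h4⟩ | ⟨h3, h4⟩⟩ := h
  · exact ⟨h2, h1, .inl ⟨h4.symm, h3.symm⟩⟩
  · exact ⟨h2, h1, .inr ⟨h3.symm, fun h => h4 h.symm⟩⟩

theorem SameForcingClass.symm {e f : V × V} (h : SameForcingClass G e f) :
    SameForcingClass G f e := by
  induction h with
  | refl => exact .refl
  | tail _ h1 ih => exact .head h1.symm ih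

theorem SameForcingClass.swap {e : V × V} {x y : V} (h : SameForcingClass G e (x, y))
    (hxy : G.Adj x y) : SameForcingClass G e (y, x) :=
  h.tail ⟨hxy, hxy.symm, .inl ⟨rfl, rfl⟩⟩

theorem SameForcingClass.of_not_adj {e : V × V} {x y z : V} (h : SameForcingClass G e (x, y))
    (hxy : G.Adj x y) (hxz : G.Adj x z) (hyz : ¬ G.Adj y z) : SameForcingClass G e (x, z) :=
  h.tail ⟨hxy, hxz, .inr ⟨rfl, hyz⟩⟩

theorem SameForcingClass.adj {e f : V × V} (h : SameForcingClass G e f) (he : G.Adj e.1 e.2) :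
    G.Adj f.1 f.2 := by
  induction h with
  | refl => exact he
  | tail _ h _ => exact h.2.1

/-- In a graph with only trivial modules, every forcing class covers all vertices. -/
theorem HasOnlyTrivialModules.exists_sameForcingClass (hG : HasOnlyTrivialModules G) {u v : V}
    (huv : G.Adj u v) (x : V) : ∃ y, SameForcingClass G (u, v) (x, y) := by
  have hu : ∃ y, SameForcingClass G (u, v) (u, y) := ⟨v, .refl⟩
  have hv : ∃ y, SameForcingClass G (u, v) (v, y) :=
    ⟨u, SameForcingClass.swap .refl huv⟩
  -- The covered vertices form a module. If an uncovered `w` saw just one end of an edge of the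
  -- class, that edge would force an edge at `w`. So `w` sees both ends alike, and this answer is
  -- constant along forcing chains.
  have hmod : IsGraphModule G {x | ∃ y, SameForcingClass G (u, v) (x, y)} := by
    intro w hw
    have hends : ∀ e : V × V, SameForcingClass G (u, v) e → (G.Adj e.1 w ↔ G.Adj e.2 w) := by
      rintro ⟨p, q⟩ h
      have hpq : G.Adj p q := h.adj huv
      constructor <;> intro h1 <;> by_contra h2
      · exact hw ⟨p, (h.of_not_adj hpq h1 h2).swap h1⟩
      · exact hw ⟨q, ((h.swap hpq).of_not_adj hpq.symm h1 h2).swap h1⟩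
    have hconst : ∀ e : V × V, SameForcingClass G (u, v) e → (G.Adj e.1 w ↔ G.Adj u w) := by
      intro e h
      induction h with
      | refl => rfl
      | tail h h1 ih =>
        obtain ⟨-, -, ⟨h3, -⟩ | ⟨h3, -⟩⟩ := h1
        · rw [h3, ← hends _ h, ih]
        · rw [h3, ih]
    by_cases huw : G.Adj u w
    · exact .inl fun x ⟨y, hy⟩ => (hconst _ hy).2 huw
    · exact .inr fun x ⟨y, hy⟩ h => huw ((hconst _ hy).1 h)
  -- The module contains the two distinct vertices `u` and `v`, so it is not a singleton.
  rcases hG _ ⟨u, hu⟩ hmod with h | ⟨z, h⟩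
  · exact (Set.ext_iff.1 h x).2 trivial
  · have h1 : u = z := (Set.ext_iff.1 h u).1 hu
    have h2 : v = z := (Set.ext_iff.1 h v).1 hv
    exact absurd (h1.trans h2.symm) huv.ne

/-- A triangle one side of which lies in a forcing class containing neither of the other two sides:
the class does not cover the opposite vertex. -/
theorem not_sameForcingClass_of_triangle {a b c : V} (hab : G.Adj a b) (hac : G.Adj a c)
    (h1 : ¬ SameForcingClass G (b, c) (a, b))
    (h2 : ¬ SameForcingClass G (b, c) (a, c)) (y : V) : ¬ SameForcingClass G (b, c) (a, y) := by
  -- This invariant survives forcing. When `(r, q)` forces `(r, s)`, a missing edge `as` would put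
  -- `ar` into the class, and `as` in the class would force `aq` into it. An edge of the class at
  -- `a` would then make `a` adjacent to itself.
  have key : ∀ e : V × V, SameForcingClass G (b, c) e → G.Adj a e.1 ∧ G.Adj a e.2 ∧
      ¬ SameForcingClass G (b, c) (a, e.1) ∧ ¬ SameForcingClass G (b, c) (a, e.2) := by
    intro e h
    induction h with
    | refl => exact ⟨hab, hac, h1, h2⟩
    | @tail e f h hef ih =>
      obtain ⟨i1, i2, i3, i4⟩ := ih
      obtain ⟨p, q⟩ := e
      obtain ⟨r, s⟩ := f
      have hf := h.tail hef
      obtain ⟨hpq, hrs, ⟨h3, h4⟩ | ⟨h3, h4⟩⟩ := hef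
      · simp only at h3 h4
        subst h3 h4
        exact ⟨i2, i1, i4, i3⟩
      · simp only at h3 h4 i1 i2 i3 i4 hpq hrs
        subst h3
        have has : G.Adj a s := by
          by_contra has
          exact i3 ((SameForcingClass.of_not_adj hf hrs i1.symm fun h => has h.symm).swap i1.symm)
        exact ⟨i1, has, i3, fun h => i4 (h.of_not_adj has i2 fun h => h4 h.symm)⟩
  exact fun h => (key _ h).1.ne rfl

/-- In a graph with only trivial modules, all edges lie in one forcing class. -/
theorem HasOnlyTrivialModules.sameForcingClass (hG : HasOnlyTrivialModules G) {u v x y : V}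
    (huv : G.Adj u v) (hxy : G.Adj x y) : SameForcingClass G (u, v) (x, y) := by
  -- No side of a triangle is alone in its class, since the class must cover the opposite vertex.
  have odd : ∀ {a b c : V}, G.Adj a b → G.Adj a c → G.Adj b c →
      SameForcingClass G (b, c) (a, b) ∨ SameForcingClass G (b, c) (a, c) := by
    intro a b c hab hac hbc
    by_contra! h
    obtain ⟨y, hy⟩ := hG.exists_sameForcingClass hbc a
    exact not_sameForcingClass_of_triangle hab hac h.1 h.2 y hy
  by_contra hne
  obtain ⟨z, hz⟩ := hG.exists_sameForcingClass huv x
  have hxz : G.Adj x z := hz.adj huv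
  have hne' : ¬ SameForcingClass G (x, z) (x, y) := fun h => hne (hz.trans h)
  have hzy : G.Adj z y := by
    by_contra h
    exact hne' (SameForcingClass.of_not_adj .refl hxz hxy h)
  -- In the triangle `xyz`, the sides `xz` and `xy` lie in different classes, so each of them must
  -- share its class with `zy`, which is impossible.
  rcases odd hxy.symm hzy.symm hxz with h | h
  · exact hne' (h.swap hxy.symm)
  rcases odd hxz.symm hzy hxy with h' | h'
  · exact hne' (h'.swap hxz.symm).symm
  · exact hne' ((h.swap hzy.symm).trans h'.symm)

/-- A graph with only trivial modules has at most one transitive orientation up to reversal. -/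
theorem IsTransitiveOrientation.eq_or_reverse (hG : HasOnlyTrivialModules G) {D D' : Digraph V}
    (hD : IsTransitiveOrientation G D) (hD' : IsTransitiveOrientation G D') :
    (∀ u v, D.Adj u v ↔ D'.Adj u v) ∨ (∀ u v, D.Adj u v ↔ D'.Adj v u) := by
  -- If one of the two edges entered `p` and the other left it, transitivity would make `q` and `r`
  -- adjacent.
  have forced : ∀ {D : Digraph V}, IsTransitiveOrientation G D → ∀ {p q r : V}, G.Adj p q →
      G.Adj p r → ¬ G.Adj q r → (D.Adj p q ↔ D.Adj p r) := by
    intro D hD p q r hpq hpr hqr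
    have hqr' := fun h => hqr ((hD.adj_iff q r).2 h)
    constructor <;> intro h
    · exact ((hD.adj_iff p r).1 hpr).resolve_right fun h1 => hqr' (.inr (hD.trans _ _ _ h1 h))
    · exact ((hD.adj_iff p q).1 hpq).resolve_right fun h1 => hqr' (.inl (hD.trans _ _ _ h1 h))
  have hrev : ∀ {D : Digraph V}, IsTransitiveOrientation G D → ∀ {p q : V}, G.Adj p q →
      (D.Adj q p ↔ ¬ D.Adj p q) := fun hD p q h =>
    ⟨fun h1 => hD.asymm _ _ h1, fun h1 => ((hD.adj_iff p q).1 h).resolve_left h1⟩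
  -- Agreement of the two orientations is constant on a forcing class; with a single class, one
  -- disagreement spreads to all edges.
  have hagree : ∀ e f : V × V, SameForcingClass G e f →
      ((D.Adj e.1 e.2 ↔ D'.Adj e.1 e.2) ↔ (D.Adj f.1 f.2 ↔ D'.Adj f.1 f.2)) := by
    intro e f h
    induction h with
    | refl => rfl
    | @tail f g _ h ih =>
      rw [ih]
      obtain ⟨p, q⟩ := f
      obtain ⟨r, s⟩ := g
      obtain ⟨h1, h2, ⟨h3, h4⟩ | ⟨h3, h4⟩⟩ := h <;> simp only at h1 h2 h3 h4 ⊢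
      · subst h3 h4
        rw [hrev hD h1, hrev hD' h1, not_iff_not]
      · subst h3
        rw [forced hD h1 h2 h4, forced hD' h1 h2 h4]
  have hnon : ∀ {u v : V}, ¬ G.Adj u v → ¬ D.Adj u v ∧ ¬ D'.Adj u v := fun h =>
    ⟨fun h1 => h ((hD.adj_iff _ _).2 (.inl h1)), fun h1 => h ((hD'.adj_iff _ _).2 (.inl h1))⟩
  by_cases hall : ∀ u v, G.Adj u v → (D.Adj u v ↔ D'.Adj u v)
  · refine .inl fun u v => ?_
    by_cases huv : G.Adj u v
    · exact hall u v huv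
    · simp [hnon huv]
  · push Not at hall
    obtain ⟨x, y, hxy, hne⟩ := hall
    refine .inr fun u v => ?_
    by_cases huv : G.Adj u v
    · have h1 := hagree _ _ (hG.sameForcingClass hxy huv)
      have h2 := hrev hD' huv
      simp only at h1
      tauto
    · simp [hnon huv, hnon fun h => huv h.symm]

/-- A graph and its complement have the same modules; this lets the uniqueness of orientations apply
to non-inversions. -/
theorem HasOnlyTrivialModules.compl (hG : HasOnlyTrivialModules G) :
    HasOnlyTrivialModules Gᶜ := by
  intro M hM hmod
  refine hG M hM fun v hv => ?_
  have hne : ∀ u ∈ M, u ≠ v := fun u hu h => hv (h ▸ hu)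
  rcases hmod v hv with h | h
  · exact .inr fun u hu => ((SimpleGraph.compl_adj _ _ _).1 (h u hu)).2
  · refine .inl fun u hu => ?_
    by_contra h'
    exact h u hu ((SimpleGraph.compl_adj _ _ _).2 ⟨hne u hu, h'⟩)

end Forcing

/-! ## Crossings in the realization -/

section Crossings

variable {n : ℕ}

theorem mem_openSegment_iff_sub {p q x : ℝ × ℝ} :
    x ∈ openSegment ℝ p q ↔ ∃ t : ℝ, 0 < t ∧ t < 1 ∧
      x = (p.1 + t * (q.1 - p.1), p.2 + t * (q.2 - p.2)) := by
  constructor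
  · rintro ⟨s, t, hs, ht, hst, rfl⟩
    refine ⟨t, ht, by linarith, ?_⟩
    obtain rfl : s = 1 - t := by linarith
    ext <;> simp <;> ring
  · rintro ⟨t, h0, h1, rfl⟩
    refine ⟨1 - t, t, by linarith, h0, by ring, ?_⟩
    ext <;> simp <;> ring

/-- The edges from `a` to `i` and from `b` to `j` meet iff `(j, i)` is an inversion. -/
theorem openSegment_inter_nonempty_iff (π : Equiv.Perm (Fin n)) (i j : Fin n) :
    (openSegment ℝ (realizationPos π (.inl 0)) (realizationPos π (.inr i)) ∩
      openSegment ℝ (realizationPos π (.inl 1)) (realizationPos π (.inr j))).Nonempty ↔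
    (j, i) ∈ inversionSet π := by
  have hA : slopeA n (π⁻¹ i) < slopeA n (π⁻¹ j) ↔ π⁻¹ i < π⁻¹ j :=
    (slopeA_strictMono n).lt_iff_lt
  have hB : slopeB n j < slopeB n i ↔ j < i := (slopeB_strictMono n).lt_iff_lt
  have a1 := slopeA_pos n (π⁻¹ i)
  have a2 := slopeA_pos n (π⁻¹ j)
  have b1 := slopeB_pos n i
  have b2 := slopeB_pos n j
  simp only [inversionSet, Set.mem_ofPred_eq, ← hA, ← hB]
  simp only [Set.Nonempty, Set.mem_inter_iff, mem_openSegment_iff_sub, realizationPos,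
    Sum.elim_inl, Sum.elim_inr, Matrix.cons_val_zero, Matrix.cons_val_one, vertexPoint]
  generalize slopeA n (π⁻¹ i) = α at *
  generalize slopeA n (π⁻¹ j) = α' at *
  generalize slopeB n i = β at *
  generalize slopeB n j = β' at *
  constructor
  · rintro ⟨x, ⟨s, s0, s1, rfl⟩, ⟨t, t0, t1, h⟩⟩
    simp only [Prod.mk.injEq, zero_add, sub_zero] at h
    obtain ⟨h1, h2⟩ := h
    field_simp at h1 h2
    -- The two lines meet at explicit parameters `s` and `t`, positive in any case; `s < 1` amounts
    -- to `β' < β` and `t < 1` to `α < α'`.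
    have hs : s * (β * (α + β')) = β' * (α + β) :=
      mul_right_cancel₀ (b := α' + β') (by positivity) (by linear_combination β' * h1 + h2)
    have ht : t * (α' * (α + β')) = α * (α' + β') :=
      mul_left_cancel₀ (a := α + β) (by positivity) (by linear_combination α * h1 - h2)
    constructor
    · have := mul_lt_mul_of_pos_right s1 (show 0 < β * (α + β') by positivity)
      exact lt_of_mul_lt_mul_right (by linarith : β' * α < β * α) a1.le
    · have := mul_lt_mul_of_pos_right t1 (show 0 < α' * (α + β') by positivity)
      exact lt_of_mul_lt_mul_right (by linarith : α * β' < α' * β') b2.le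
  · rintro ⟨h1, h2⟩
    have e1 : 0 < α + β' := by linarith
    -- This is the intersection of `y = α x` with `y = β' (1 - x)`.
    refine ⟨(β' / (α + β'), α * β' / (α + β')),
      ⟨β' * (α + β) / (β * (α + β')), by positivity, ?_, ?_⟩,
      ⟨α * (α' + β') / (α' * (α + β')), by positivity, ?_, ?_⟩⟩
    · rw [div_lt_one (by positivity)]; nlinarith
    · ext <;> simp <;> field_simp
    · rw [div_lt_one (by positivity)]; nlinarith
    · ext <;> simp <;> (field_simp; try ring)

/-- Edges with a common centre have no common interior point, so a crossing involves one edge at `a`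
and one at `b`. Unordered pairs absorb the order in which the ends are listed. -/
theorem crosses_iff_exists (π : Equiv.Perm (Fin n)) (x y u v : Fin 2 ⊕ Fin n) :
    (permRealization π).Crosses x y u v ↔ ∃ i j, (j, i) ∈ inversionSet π ∧
      ((s(x, y) = s(.inl 0, .inr i) ∧ s(u, v) = s(.inl 1, .inr j)) ∨
        (s(x, y) = s(.inl 1, .inr j) ∧ s(u, v) = s(.inl 0, .inr i))) := by
  constructor
  · rintro ⟨h1, h2, h3, h4⟩
    obtain ⟨c, i, e1, s1⟩ := completeBipartite_edge_cases π x y h1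
    obtain ⟨d, j, e2, s2⟩ := completeBipartite_edge_cases π u v h2
    change (openSegment ℝ (realizationPos π x) (realizationPos π y) ∩
      openSegment ℝ (realizationPos π u) (realizationPos π v)).Nonempty at h4
    rw [s1, s2] at h4
    rw [e1, e2] at h3 ⊢
    have hcd : c ≠ d := by
      rintro rfl
      obtain ⟨p, p1, p2⟩ := h4
      exact not_openSegment_realizationPos π c i j (fun h => h3 (by rw [h])) p p1 p2
    have hc : (c = 0 ∧ d = 1) ∨ (c = 1 ∧ d = 0) := by omega
    rcases hc with ⟨rfl, rfl⟩ | ⟨rfl, rfl⟩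
    · exact ⟨i, j, (openSegment_inter_nonempty_iff π i j).1 h4, .inl ⟨rfl, rfl⟩⟩
    · rw [Set.inter_comm] at h4
      exact ⟨j, i, (openSegment_inter_nonempty_iff π j i).1 h4, .inr ⟨rfl, rfl⟩⟩
  · rintro ⟨i, j, h, h'⟩
    have hne : openSegment ℝ (realizationPos π (.inl 0)) (realizationPos π (.inr i)) ∩
      openSegment ℝ (realizationPos π (.inl 1)) (realizationPos π (.inr j)) ≠ ∅ :=
      ((openSegment_inter_nonempty_iff π i j).2 h).ne_empty
    simp only [Sym2.eq_iff] at h'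
    unfold GeometricGraph.Crosses
    rcases h' with ⟨⟨rfl, rfl⟩ | ⟨rfl, rfl⟩, ⟨rfl, rfl⟩ | ⟨rfl, rfl⟩⟩ |
        ⟨⟨rfl, rfl⟩ | ⟨rfl, rfl⟩, ⟨rfl, rfl⟩ | ⟨rfl, rfl⟩⟩ <;>
      refine ⟨by simp [permRealization], by simp [permRealization], by simp, ?_⟩ <;>
      rw [Set.nonempty_iff_ne_empty] <;> simp only [permRealization] <;>
      first
      | simpa only [openSegment_symm ℝ _ (realizationPos π (.inl _))] using hne
      | simpa only [openSegment_symm ℝ _ (realizationPos π (.inl _)), Set.inter_comm] using hne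

theorem crosses_inl_inr_iff (π : Equiv.Perm (Fin n)) (c d : Fin 2) (i j : Fin n) :
    (permRealization π).Crosses (.inl c) (.inr i) (.inl d) (.inr j) ↔
      (c = 0 ∧ d = 1 ∧ (j, i) ∈ inversionSet π) ∨ (c = 1 ∧ d = 0 ∧ (i, j) ∈ inversionSet π) := by
  rw [crosses_iff_exists]
  simp only [Sym2.eq_iff, Sum.inl.injEq, Sum.inr.injEq, reduceCtorEq, false_and, or_false]
  constructor
  · rintro ⟨i', j', h, ⟨⟨rfl, rfl⟩, rfl, rfl⟩ | ⟨⟨rfl, rfl⟩, rfl, rfl⟩⟩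
    · exact .inl ⟨rfl, rfl, h⟩
    · exact .inr ⟨rfl, rfl, h⟩
  · rintro (⟨rfl, rfl, h⟩ | ⟨rfl, rfl, h⟩)
    · exact ⟨i, j, h, .inl ⟨⟨rfl, rfl⟩, rfl, rfl⟩⟩
    · exact ⟨j, i, h, .inr ⟨⟨rfl, rfl⟩, rfl, rfl⟩⟩

/-! ## Geo-equivalence in terms of inversion sets -/

/-- A bijection of `Fin n` which maps inversions to inversions. -/
def InversionIso (σ π : Equiv.Perm (Fin n)) (f : Equiv.Perm (Fin n)) : Prop :=
  ∀ i j, (i, j) ∈ inversionSet σ ↔ (f i, f j) ∈ inversionSet π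

/-- A bijection of `Fin n` which maps inversions to reversed inversions. -/
def InversionAntiIso (σ π : Equiv.Perm (Fin n)) (f : Equiv.Perm (Fin n)) : Prop :=
  ∀ i j, (i, j) ∈ inversionSet σ ↔ (f j, f i) ∈ inversionSet π

theorem sum_map_edge_eq_iff (g : Equiv.Perm (Fin 2)) (f : Equiv.Perm (Fin n))
    (x y : Fin 2 ⊕ Fin n) (c : Fin 2) (i : Fin n) :
    s(Equiv.sumCongr g f x, Equiv.sumCongr g f y) = s(.inl (g c), .inr (f i)) ↔
      s(x, y) = s(.inl c, .inr i) := by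
  have h1 : (Sum.inl (g c) : Fin 2 ⊕ Fin n) = Equiv.sumCongr g f (.inl c) := rfl
  have h2 : (Sum.inr (f i) : Fin 2 ⊕ Fin n) = Equiv.sumCongr g f (.inr i) := rfl
  rw [h1, h2]
  simp only [Sym2.eq_iff, EmbeddingLike.apply_eq_iff_eq]

theorem adj_sumCongr_iff (σ π : Equiv.Perm (Fin n)) (g : Equiv.Perm (Fin 2))
    (f : Equiv.Perm (Fin n)) (u v : Fin 2 ⊕ Fin n) :
    (permRealization σ).graph.Adj u v ↔
      (permRealization π).graph.Adj (Equiv.sumCongr g f u) (Equiv.sumCongr g f v) := by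
  rcases u with u | u <;> rcases v with v | v <;> simp [permRealization]

theorem InversionIso.geoEquiv {σ π f : Equiv.Perm (Fin n)} (h : InversionIso σ π f) :
    GeoEquiv σ π := by
  refine ⟨⟨Equiv.sumCongr 1 f, adj_sumCongr_iff σ π 1 f, fun x y u v => Iff.symm ?_⟩⟩
  rw [crosses_iff_exists, crosses_iff_exists, ← f.exists_congr_right]
  refine exists_congr fun i => ?_
  rw [← f.exists_congr_right]
  refine exists_congr fun j => ?_
  rw [← h j i]
  have h0 := fun x y => sum_map_edge_eq_iff 1 f x y 0
  have h1 := fun x y => sum_map_edge_eq_iff 1 f x y 1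
  simp only [Equiv.Perm.coe_one, id] at h0 h1
  simp only [h0, h1]

/-- Exchanging `a` and `b` turns the crossing that records `(j, i)` into one that records `(i, j)`,
which compensates for the reversal. -/
theorem InversionAntiIso.geoEquiv {σ π f : Equiv.Perm (Fin n)} (h : InversionAntiIso σ π f) :
    GeoEquiv σ π := by
  refine ⟨⟨Equiv.sumCongr (Equiv.swap 0 1) f, adj_sumCongr_iff σ π _ f, fun x y u v => Iff.symm ?_⟩⟩
  rw [crosses_iff_exists, crosses_iff_exists, exists_comm, ← f.exists_congr_right]
  refine exists_congr fun i => ?_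
  rw [← f.exists_congr_right]
  refine exists_congr fun j => ?_
  rw [← h j i]
  have h0 := fun x y => sum_map_edge_eq_iff (Equiv.swap 0 1) f x y 0
  have h1 := fun x y => sum_map_edge_eq_iff (Equiv.swap 0 1) f x y 1
  simp only [Equiv.swap_apply_left, Equiv.swap_apply_right] at h0 h1
  simp only [h0, h1]
  rw [or_comm]

/-- A bijection of the vertices preserving the adjacency of `K_{2,n}`, `n ≠ 2`, preserves the two
sides. -/
theorem exists_eq_inl_of_adj_iff (hn : n ≠ 2) (e : Fin 2 ⊕ Fin n ≃ Fin 2 ⊕ Fin n)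
    (he : ∀ u v, (completeBipartiteGraph (Fin 2) (Fin n)).Adj u v ↔
      (completeBipartiteGraph (Fin 2) (Fin n)).Adj (e u) (e v)) (c : Fin 2) :
    ∃ d, e (.inl c) = .inl d := by
  rcases h : e (.inl c) with d | i
  · exact ⟨d, rfl⟩
  exfalso
  have h1 : ∀ v, v.isLeft ↔ (e v).isRight := by
    intro v
    have := he (.inl c) v
    rw [h] at this
    rcases v with v | v <;> rcases h' : e _ with w | w <;> simp_all
  -- A centre sent to the other side makes the bijection exchange the two sides, and counting gives
  -- `2 = n`.
  have h2 : Nat.card {v : Fin 2 ⊕ Fin n // v.isLeft} = Nat.card {v : Fin 2 ⊕ Fin n // v.isRight} :=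
    Nat.card_congr (e.subtypeEquiv h1)
  rw [Nat.card_congr Equiv.sumIsLeft, Nat.card_congr Equiv.sumIsRight, Nat.card_fin,
    Nat.card_fin] at h2
  exact hn h2.symm

/-- Geo-equivalent permutations have isomorphic or anti-isomorphic digraphs. -/
theorem GeoEquiv.exists_inversionIso {σ π : Equiv.Perm (Fin n)} (h : GeoEquiv σ π) :
    ∃ f, InversionIso σ π f ∨ InversionAntiIso σ π f := by
  obtain ⟨e, hadj, hcr⟩ := h
  -- The 4-cycle has automorphisms exchanging its sides, so it is treated apart: its only possible
  -- inversion is `(0, 1)`, present iff anything crosses.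
  by_cases hn : n = 2
  · subst hn
    have hE : ∀ (τ : Equiv.Perm (Fin 2)) (i j : Fin 2), (i, j) ∈ inversionSet τ ↔
        i = 0 ∧ j = 1 ∧ ∃ x y u v, (permRealization τ).Crosses x y u v := by
      intro τ i j
      constructor
      · intro h
        have h1 : i < j := h.1
        exact ⟨by omega, by omega, _, _, _, _,
          (crosses_inl_inr_iff τ 1 0 i j).2 (.inr ⟨rfl, rfl, h⟩)⟩
      · rintro ⟨rfl, rfl, x, y, u, v, h⟩
        obtain ⟨i, j, h, -⟩ := (crosses_iff_exists τ x y u v).1 h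
        have h1 : j < i := h.1
        obtain ⟨rfl, rfl⟩ : i = 1 ∧ j = 0 := by omega
        exact h
    refine ⟨1, .inl fun i j => ?_⟩
    rw [hE σ, hE π, Equiv.Perm.coe_one, id, id]
    refine and_congr_right fun _ => and_congr_right fun _ => ?_
    simp only [hcr]
    constructor
    · rintro ⟨x, y, u, v, h⟩
      exact ⟨_, _, _, _, h⟩
    · rintro ⟨x, y, u, v, h⟩
      refine ⟨e.symm x, e.symm y, e.symm u, e.symm v, ?_⟩
      simpa using h
  · choose g hg using exists_eq_inl_of_adj_iff hn e hadj
    have hr : ∀ i, ∃ j, e (.inr i) = .inr j := by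
      intro i
      have := (hadj (.inl 0) (.inr i)).1 (by simp [permRealization])
      rw [hg] at this
      rcases h : e (.inr i) with w | w
      · rw [h] at this
        simp [permRealization] at this
      · exact ⟨w, rfl⟩
    choose f hf using hr
    have hfi : Function.Injective f := fun i j hij =>
      Sum.inr.inj (e.injective (by rw [hf, hf, hij]))
    have hgi : g 0 ≠ g 1 := fun h => by
      have := e.injective ((hg 0).trans ((congrArg _ h).trans (hg 1).symm))
      simp at this
    refine ⟨Equiv.ofBijective f hfi.bijective_of_finite, ?_⟩
    have hc : ∀ i j, (j, i) ∈ inversionSet σ ↔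
        (permRealization π).Crosses (.inl (g 0)) (.inr (f i)) (.inl (g 1)) (.inr (f j)) := by
      intro i j
      rw [← hg, ← hg, ← hf, ← hf, ← hcr, crosses_inl_inr_iff]
      simp
    have hg' : (g 0 = 0 ∧ g 1 = 1) ∨ (g 0 = 1 ∧ g 1 = 0) := by omega
    rcases hg' with ⟨h0, h1⟩ | ⟨h0, h1⟩
    · refine .inl fun i j => ?_
      rw [hc, h0, h1, crosses_inl_inr_iff]
      simp
    · refine .inr fun i j => ?_
      rw [hc, h0, h1, crosses_inl_inr_iff]
      simp

end Crossings

/-! ### Recovering a permutation from its inversions and non-inversions -/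

section Classes

variable {n : ℕ}

/-- The digraph of the pairs `i < j` which are not inversions of `π`. -/
def nonInversionDigraph (π : Equiv.Perm (Fin n)) : Digraph (Fin n) where
  Adj i j := i < j ∧ π⁻¹ i < π⁻¹ j

theorem lt_iff_nonInversion_or (π : Equiv.Perm (Fin n)) (i j : Fin n) :
    i < j ↔ (nonInversionDigraph π).Adj i j ∨ (i, j) ∈ inversionSet π := by
  have : π⁻¹ i = π⁻¹ j ↔ i = j := EmbeddingLike.apply_eq_iff_eq _
  simp only [nonInversionDigraph, inversionSet, Set.mem_ofPred_eq]
  lia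

theorem inv_lt_inv_iff_nonInversion_or (π : Equiv.Perm (Fin n)) (i j : Fin n) :
    π⁻¹ i < π⁻¹ j ↔ (nonInversionDigraph π).Adj i j ∨ (j, i) ∈ inversionSet π := by
  have : π⁻¹ i = π⁻¹ j ↔ i = j := EmbeddingLike.apply_eq_iff_eq _
  simp only [nonInversionDigraph, inversionSet, Set.mem_ofPred_eq]
  lia

theorem isTransitiveOrientation_permDigraph (π : Equiv.Perm (Fin n)) :
    IsTransitiveOrientation (permGraph π) (permDigraph π) where
  adj_iff _ _ := Iff.rfl
  asymm _ _ h h' := lt_asymm h.1 h'.1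
  trans _ _ _ h h' := ⟨h.1.trans h'.1, h'.2.trans h.2⟩

theorem isTransitiveOrientation_nonInversionDigraph (π : Equiv.Perm (Fin n)) :
    IsTransitiveOrientation (permGraph π)ᶜ (nonInversionDigraph π) where
  adj_iff i j := by
    have : π⁻¹ i = π⁻¹ j ↔ i = j := EmbeddingLike.apply_eq_iff_eq _
    simp only [SimpleGraph.compl_adj, permGraph, nonInversionDigraph, inversionSet,
      Set.mem_ofPred_eq]
    lia
  asymm _ _ h h' := lt_asymm h.1 h'.1
  trans _ _ _ h h' := ⟨h.1.trans h'.1, h.2.trans h'.2⟩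

/-- A finite linear order has no other automorphism; comparisons of orders become equalities of
permutations through this. -/
theorem perm_eq_one_of_strictMono {f : Equiv.Perm (Fin n)} (hf : ∀ i j, i < j → f i < f j) :
    f = 1 := by
  have hf' : StrictMono f := fun i j h => hf i j h
  have h := Subsingleton.elim (hf'.orderIsoOfSurjective f f.surjective) (OrderIso.refl _)
  ext i
  exact congrArg Fin.val (DFunLike.congr_fun h i)

/-- The four permutations thus arise from `π` by inversion and by conjugation with the reversal, two
commuting involutions. -/
theorem permRev_inv_permRev (π : Equiv.Perm (Fin n)) :
    permRev (permRev π)⁻¹ = Fin.revPerm * π⁻¹ * Fin.revPerm := by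
  simp only [permRev, mul_inv_rev]
  rfl

theorem revPerm_mul_revPerm : (Fin.revPerm * Fin.revPerm : Equiv.Perm (Fin n)) = 1 := by
  ext i; simp

theorem permRev_inv_permRev_inv (π : Equiv.Perm (Fin n)) :
    (permRev (permRev π)⁻¹)⁻¹ = Fin.revPerm * π * Fin.revPerm := by
  rw [permRev_inv_permRev, mul_inv_rev, mul_inv_rev, inv_inv, ← mul_assoc]
  rfl

/-- If the graph of `π` has only trivial modules, only two permutations have a digraph isomorphic to
that of `π`. -/
theorem InversionIso.eq_or_eq {σ π f : Equiv.Perm (Fin n)} (hf : InversionIso σ π f)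
    (hπ : HasOnlyTrivialModules (permGraph π)) : σ = π ∨ σ = permRev (permRev π)⁻¹ := by
  have hE : ∀ u v, (f⁻¹ u, f⁻¹ v) ∈ inversionSet σ ↔ (u, v) ∈ inversionSet π := by
    intro u v
    rw [hf, ← Equiv.Perm.mul_apply, ← Equiv.Perm.mul_apply, mul_inv_cancel]
    rfl
  have hσ := isTransitiveOrientation_nonInversionDigraph σ
  -- The non-inversions of `σ`, carried over by `f`, orient the complement of `G(π)`, so they match
  -- those of `π` up to reversal.
  let D : Digraph (Fin n) := ⟨fun u v => (nonInversionDigraph σ).Adj (f⁻¹ u) (f⁻¹ v)⟩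
  have hD : IsTransitiveOrientation (permGraph π)ᶜ D :=
    { adj_iff := fun u v => by
        rw [← hσ.adj_iff]
        simp only [SimpleGraph.compl_adj, permGraph, hE, ne_eq, EmbeddingLike.apply_eq_iff_eq]
      asymm := fun _ _ h => hσ.asymm _ _ h
      trans := fun _ _ _ h h' => hσ.trans _ _ _ h h' }
  have hadj : ∀ i j, D.Adj (f i) (f j) ↔ (nonInversionDigraph σ).Adj i j := by
    intro i j
    simp [D]
  rcases hD.eq_or_reverse hπ.compl (isTransitiveOrientation_nonInversionDigraph π) with h | h
  -- With equal orientations `f` preserves the label order, hence is the identity; then the position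
  -- orders agree too.
  · left
    have h1 : f = 1 := perm_eq_one_of_strictMono fun i j hij => by
      rw [lt_iff_nonInversion_or σ, ← hadj, h, hf] at hij
      exact (lt_iff_nonInversion_or π _ _).2 hij
    subst h1
    have h2 : π⁻¹ * σ = 1 := perm_eq_one_of_strictMono fun i j hij => by
      have h3 : σ⁻¹ (σ i) < σ⁻¹ (σ j) := by simpa using hij
      rw [inv_lt_inv_iff_nonInversion_or, ← hadj, h, hf] at h3
      exact (inv_lt_inv_iff_nonInversion_or π _ _).2 h3
    exact (inv_mul_eq_one.1 h2).symm
  -- With reversed orientations `f` takes the label order of `σ` to the reversed position order of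
  -- `π`, and the position order of `σ` to the reversed label order. Eliminating `f` determines `σ`.
  · right
    have h1 : Fin.revPerm * π⁻¹ * f = 1 := perm_eq_one_of_strictMono fun i j hij => by
      rw [lt_iff_nonInversion_or σ, ← hadj, h, hf] at hij
      exact Fin.rev_lt_rev.2 ((inv_lt_inv_iff_nonInversion_or π _ _).2 hij)
    have h2 : Fin.revPerm * f * σ = 1 := perm_eq_one_of_strictMono fun i j hij => by
      have h3 : σ⁻¹ (σ i) < σ⁻¹ (σ j) := by simpa using hij
      rw [inv_lt_inv_iff_nonInversion_or, ← hadj, h, hf] at h3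
      exact Fin.rev_lt_rev.2 ((lt_iff_nonInversion_or π _ _).2 h3)
    rw [permRev_inv_permRev, eq_inv_of_mul_eq_one_right h2, mul_inv_rev,
      ← eq_inv_of_mul_eq_one_left h1]
    rfl

/-! ### The geo-equivalence class and its size -/

/-- Inversion exchanges labels with positions, and an inversion is a pair on which the two orders
disagree. -/
theorem inversionAntiIso_inv (π : Equiv.Perm (Fin n)) : InversionAntiIso π⁻¹ π π := by
  intro i j
  simp [inversionSet, and_comm]

theorem inversionAntiIso_permRev (π : Equiv.Perm (Fin n)) :
    InversionAntiIso (permRev (permRev π)⁻¹) π⁻¹ Fin.revPerm := by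
  intro i j
  simp only [inversionSet, Set.mem_ofPred_eq, permRev_inv_permRev_inv, inv_inv,
    Equiv.Perm.mul_apply, Fin.revPerm_apply, Fin.rev_lt_rev]

/-- Two reversals cancel, so the anti-isomorphic case reduces to the isomorphic one for `σ⁻¹`. -/
theorem InversionAntiIso.inversionIso_inv {σ π f : Equiv.Perm (Fin n)}
    (h : InversionAntiIso σ π f) : InversionIso σ⁻¹ π (f * σ) := by
  intro i j
  rw [inversionAntiIso_inv, h]
  rfl

theorem mem_fourPerms {σ π : Equiv.Perm (Fin n)} : σ ∈ fourPerms π ↔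
    σ = π ∨ σ = π⁻¹ ∨ σ = permRev (permRev π)⁻¹ ∨ σ = (permRev (permRev π)⁻¹)⁻¹ := by
  simp [fourPerms]

theorem geoClass_eq_fourPerms {π : Equiv.Perm (Fin n)}
    (hπ : HasOnlyTrivialModules (permGraph π)) : geoClass π = {σ | σ ∈ fourPerms π} := by
  ext σ
  rw [Set.mem_ofPred_eq, mem_fourPerms]
  constructor
  · intro h
    obtain ⟨f, hf | hf⟩ := GeoEquiv.exists_inversionIso h
    · rcases hf.eq_or_eq hπ with h | h <;> simp [h]
    · rcases hf.inversionIso_inv.eq_or_eq hπ with h | h <;>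
        rw [inv_eq_iff_eq_inv] at h <;> simp [h]
  · have hinv : ∀ τ : Equiv.Perm (Fin n), GeoEquiv τ⁻¹ τ := fun τ =>
      (inversionAntiIso_inv τ).geoEquiv
    have htr : ∀ {α β γ : Equiv.Perm (Fin n)}, GeoEquiv α β → GeoEquiv β γ → GeoEquiv α γ :=
      (geoSetoid n).iseqv.trans
    have hrev : GeoEquiv (permRev (permRev π)⁻¹) π :=
      htr (inversionAntiIso_permRev π).geoEquiv (hinv π)
    rintro (rfl | rfl | rfl | rfl)
    · exact (geoSetoid n).iseqv.refl _
    · exact hinv π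
    · exact hrev
    · exact htr (hinv _) hrev

theorem card_fourPerms (π : Equiv.Perm (Fin n)) :
    (fourPerms π).toFinset.card = 4 ∨ (fourPerms π).toFinset.card = 2 ∨
      (fourPerms π).toFinset.card = 1 := by
  -- Each involution carries an equality in the list to the complementary one, so coincidences come
  -- in pairs and three distinct values cannot occur.
  have key : ∀ a b c d : Equiv.Perm (Fin n), (a = b ↔ c = d) → (a = c ↔ b = d) →
      (a = d ↔ b = c) → ({a, b, c, d} : Multiset _).toFinset.card = 4 ∨
      ({a, b, c, d} : Multiset _).toFinset.card = 2 ∨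
      ({a, b, c, d} : Multiset _).toFinset.card = 1 := by
    intro a b c d h1 h2 h3
    by_cases hab : a = b <;> by_cases hac : a = c <;> by_cases had : a = d <;>
      simp_all [Finset.card_insert_of_notMem]
  have hconj : ∀ {α β : Equiv.Perm (Fin n)}, α = Fin.revPerm * β * Fin.revPerm ↔
      β = Fin.revPerm * α * Fin.revPerm := by
    intro α β
    have := revPerm_mul_revPerm (n := n)
    constructor <;> rintro rfl <;> simp [mul_assoc, this] <;> simp [← mul_assoc, this]
  refine key _ _ _ _ ?_ ?_ ?_
  · rw [permRev_inv_permRev_inv, permRev_inv_permRev]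
    simp [eq_comm]
  · rw [permRev_inv_permRev_inv, permRev_inv_permRev, hconj]
  · exact inv_eq_iff_eq_inv.symm

/-- The only candidates for `D` are `D(π)` and its reverse, and geo-equivalence does not distinguish
a digraph from its reverse. -/
theorem Represents.geoEquiv {σ π : Equiv.Perm (Fin n)} {D : Digraph (Fin n)}
    (hD : IsTransitiveOrientation (permGraph π) D) (hσ : Represents D σ)
    (hπ : HasOnlyTrivialModules (permGraph π)) : GeoEquiv π σ := by
  obtain ⟨g⟩ := hσ
  rcases hD.eq_or_reverse hπ (isTransitiveOrientation_permDigraph π) with h | h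
  · exact InversionIso.geoEquiv (f := g.toEquiv) fun i j => (h i j).symm.trans g.map_rel_iff.symm
  · exact InversionAntiIso.geoEquiv (f := g.toEquiv) fun i j =>
      (h j i).symm.trans g.map_rel_iff.symm

/-! ### Examples for the sizes four, two and one -/

/-- Quantifying over finite sets makes the condition decidable, so the examples can be checked by
evaluation. -/
theorem hasOnlyTrivialModules_of_finset {G : SimpleGraph (Fin n)}
    (h : ∀ M : Finset (Fin n), M.Nonempty →
      (∀ v, v ∉ M → (∀ u ∈ M, G.Adj u v) ∨ (∀ u ∈ M, ¬ G.Adj u v)) →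
      M = Finset.univ ∨ ∃ v, M = {v}) : HasOnlyTrivialModules G := by
  classical
  intro M hM hmod
  have := h M.toFinset (by simpa using hM) (by simpa [IsGraphModule] using hmod)
  simpa [← Finset.coe_inj] using this

instance (π : Equiv.Perm (Fin n)) : DecidableRel (permGraph π).Adj := fun i j =>
  inferInstanceAs (Decidable ((i < j ∧ π⁻¹ j < π⁻¹ i) ∨ (j < i ∧ π⁻¹ i < π⁻¹ j)))

end Classes

theorem exists_card_fourPerms_eq (c : ℕ) (hc : c = 4 ∨ c = 2 ∨ c = 1) :
    ∃ (n : ℕ) (π : Equiv.Perm (Fin n)), 4 ≤ n ∧ HasOnlyTrivialModules (permGraph π) ∧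
      (fourPerms π).toFinset.card = c := by
  rcases hc with rfl | rfl | rfl
  -- In one-line notation from 1, the examples are 246153 (no symmetry), 2413 (commutes with the
  -- reversal but is no involution) and 351624 (an involution commuting with the reversal).
  · exact ⟨6, ⟨![1, 3, 5, 0, 4, 2], ![3, 0, 5, 1, 4, 2], by decide, by decide⟩, by norm_num,
      hasOnlyTrivialModules_of_finset (by decide +kernel), by decide +kernel⟩
  · exact ⟨4, ⟨![1, 3, 0, 2], ![2, 0, 3, 1], by decide, by decide⟩, by norm_num,
      hasOnlyTrivialModules_of_finset (by decide +kernel), by decide +kernel⟩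
  · exact ⟨6, ⟨![2, 4, 0, 5, 1, 3], ![2, 4, 0, 5, 1, 3], by decide, by decide⟩, by norm_num,
      hasOnlyTrivialModules_of_finset (by decide +kernel), by decide +kernel⟩

theorem mainTheorem8 :
    (∀ (n : ℕ) (π : Equiv.Perm (Fin n)), HasOnlyTrivialModules (permGraph π) →
      geoClass π = {σ | σ ∈ fourPerms π} ∧
      ((fourPerms π).toFinset.card = 4 ∨ (fourPerms π).toFinset.card = 2 ∨
        (fourPerms π).toFinset.card = 1) ∧
      ∀ C ∈ (geoSetoid n).classes,
        (∃ D : Digraph (Fin n), IsTransitiveOrientation (permGraph π) D ∧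
          ∃ σ ∈ C, Represents D σ) ↔ C = geoClass π) ∧
    (∀ c : ℕ, c = 4 ∨ c = 2 ∨ c = 1 →
      ∃ (n : ℕ) (π : Equiv.Perm (Fin n)), 4 ≤ n ∧ HasOnlyTrivialModules (permGraph π) ∧
        (fourPerms π).toFinset.card = c) := by

  refine ⟨fun n π hπ => ⟨geoClass_eq_fourPerms hπ, card_fourPerms π, fun C hC => ⟨?_, ?_⟩⟩,
    exists_card_fourPerms_eq⟩
  · rintro ⟨D, hD, σ, hσC, hDσ⟩
    obtain ⟨τ, rfl⟩ := hC
    have h1 : GeoEquiv π σ := Represents.geoEquiv hD hDσ hπ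
    have h2 : GeoEquiv π τ := (geoSetoid n).iseqv.trans h1 hσC
    ext ρ
    exact ⟨fun h => (geoSetoid n).iseqv.trans h ((geoSetoid n).iseqv.symm h2),
      fun h => (geoSetoid n).iseqv.trans h h2⟩
  · rintro rfl
    exact ⟨permDigraph π, isTransitiveOrientation_permDigraph π, π, (geoSetoid n).iseqv.refl π,
      ⟨RelIso.refl _⟩⟩
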